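/- Let $\alpha:[0,1]\to[0,1]$ be any (Lebesgue) measurable function and define $$\phi^{(\alpha)}(\lambda)=\exp\left[\int_0^1\frac{\lambda-1}{1+(\lambda-1)x}\,\alpha(x)\,dx\right],\qquad \lambda>0 .$$ Then $\phi^{(\alpha)}$ is a complete Bernstein function. Here a function $f:(0,\infty)\to[0,\infty)$ is called a Bernstein function if $f\in C^\infty(0,\infty)$ and $(-1)^{k-1}f^{(k)}\ge 0$ on $(0,\infty)$ for all integers $k\ge 1$. Every Bernstein function has a unique Lévy–Khintchine representation $$f(\lambda)=a+b\lambda+\int_{(0,\infty)}\left(1-e^{-\lambda x}\right)\nu(dx),\qquad \lambda>0,$$ with $a,b\ge 0$ and a measure $\nu$ (the Lévy measure of $f$) on $(0,\infty)$ satisfying $\int_{(0,\infty)}\min(x,1)\,\nu(dx)<\infty$. A Bernstein function $f$ is called a complete Bernstein function if its Lévy measure $\nu$ has a completely monotone density $m$ with respect to Lebesgue measure on $(0,\infty)$, that is, a density $m\in C^\infty(0,\infty)$ with $(-1)^k m^{(k)}\ge 0$ on $(0,\infty)$ for all integers $k\ge 0$. -/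

import Mathlib

open MeasureTheory Set
open scoped ContDiff

/-- `m : (0,∞) → ℝ` is completely monotone: smooth on `(0,∞)`, and `(-1)^k m^(k) ≥ 0` there for
every `k ≥ 0`. Values of `m` outside `(0,∞)` play no role. -/
structure IsCompletelyMonotone (m : ℝ → ℝ) : Prop where
  contDiffOn : ContDiffOn ℝ ∞ m (Ioi 0)
  sign : ∀ k : ℕ, ∀ x ∈ Ioi (0 : ℝ), 0 ≤ (-1 : ℝ) ^ k * iteratedDerivWithin k m (Ioi 0) x

/-- `f : (0,∞) → [0,∞)` is a Bernstein function: smooth on `(0,∞)`, and `(-1)^(k-1) f^(k) ≥ 0`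
there for every `k ≥ 1`. Values of `f` outside `(0,∞)` play no role. -/
structure IsBernstein (f : ℝ → ℝ) : Prop where
  nonneg : ∀ l ∈ Ioi (0 : ℝ), 0 ≤ f l
  contDiffOn : ContDiffOn ℝ ∞ f (Ioi 0)
  sign : ∀ k : ℕ, 1 ≤ k → ∀ l ∈ Ioi (0 : ℝ),
    0 ≤ (-1 : ℝ) ^ (k - 1) * iteratedDerivWithin k f (Ioi 0) l

/-- `ν` is a measure carried by `(0,∞)` with `∫ min(x,1) ν(dx) < ∞`. -/
structure IsLevyMeasure (ν : Measure ℝ) : Prop where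
  carried : ν (Iic 0) = 0
  lintegral_lt_top : ∫⁻ x in Ioi (0 : ℝ), ENNReal.ofReal (min x 1) ∂ν < ⊤

/-- `(a, b, ν)` is the Lévy–Khintchine triplet of `f` (the triplet is unique): `a, b ≥ 0`, `ν` is a
Lévy measure and `f(λ) = a + bλ + ∫_{(0,∞)} (1 - e^{-λx}) ν(dx)` for `λ > 0`. The integrand is
`ν`-integrable for every Lévy measure `ν`, since `0 ≤ 1 - e^{-λx} ≤ max(λ,1) min(x,1)`. -/
structure IsLevyKhintchineTriplet (f : ℝ → ℝ) (a b : ℝ) (ν : Measure ℝ) : Prop where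
  a_nonneg : 0 ≤ a
  b_nonneg : 0 ≤ b
  levy : IsLevyMeasure ν
  repr : ∀ l ∈ Ioi (0 : ℝ), f l = a + b * l + ∫ x in Ioi (0 : ℝ), (1 - Real.exp (-(l * x))) ∂ν

/-- A complete Bernstein function is a Bernstein function whose Lévy measure has a completely
monotone density with respect to Lebesgue measure on `(0,∞)`. -/
def IsCompleteBernstein (f : ℝ → ℝ) : Prop :=
  IsBernstein f ∧ ∃ (a b : ℝ) (ν : Measure ℝ), IsLevyKhintchineTriplet f a b ν ∧
    ∃ m : ℝ → ℝ, IsCompletelyMonotone m ∧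
      ν = (volume.restrict (Ioi (0 : ℝ))).withDensity (fun x => ENNReal.ofReal (m x))

/-- `φ^(α)(λ) = exp (∫_0^1 (λ-1)/(1+(λ-1)x) α(x) dx)`, of interest for `λ > 0`, where the
denominator is at least `min(λ,1) > 0`. -/
noncomputable def marchalPhi (α : Icc (0 : ℝ) 1 → Icc (0 : ℝ) 1) (l : ℝ) : ℝ :=
  Real.exp (∫ x : Icc (0 : ℝ) 1, (l - 1) / (1 + (l - 1) * (x : ℝ)) * (α x : ℝ))

open Filter Topology

/-! The key fact is that `φ(λ)/λ` is a mixture of the kernels `1/(1+(λ-1)t)` over a probability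
measure `P` on `[0,1]`. If `α` is the indicator of finitely many intervals, the integral is a sum of
logarithms and `φ(λ)/λ` is a product of quotients whose zeros and poles interlace. Its partial
fractions therefore have nonnegative coefficients (`prod_mem_convexHull_resolventKernel`). A general
`α` is approximated by such indicators (`tendsto_prod_resolvent`), and weak compactness of the
probability measures on `[0,1]` keeps the limit a mixture (`isClosed_resolventMixtures`).

Hence `φ(λ) = ∫ λ/(1+(λ-1)t) P(dt)`. The atom at `t = 1` gives the constant `a`, the atom at `t = 0`
the drift `b`. For `0 < t < 1`, with `s = (1-t)/t`, the kernel is `(s+1)λ/(s+λ) = ∫ (1-e^{-λx})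
(s+1)s e^{-sx} dx`, so Tonelli produces a Lévy density that is a mixture of decaying exponentials,
hence completely monotone. Signs of derivatives are read off under the integral. -/

theorem min_le_one_add_mul {l t : ℝ} (ht : t ∈ Icc (0 : ℝ) 1) : min l 1 ≤ 1 + (l - 1) * t := by
  obtain ⟨h0, h1⟩ := ht
  rcases le_total l 1 with h | h
  · rw [min_eq_left h]; nlinarith
  · rw [min_eq_right h]; nlinarith

theorem one_add_mul_pos {l t : ℝ} (hl : 0 < l) (ht : t ∈ Icc (0 : ℝ) 1) :
    0 < 1 + (l - 1) * t :=
  (lt_min hl one_pos).trans_le (min_le_one_add_mul ht)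

/-! ### Partial fractions with interlacing zeros and poles -/

/-- The kernel `λ ↦ 1 / (1 + (λ - 1) t)` on `(0,∞)`. -/
noncomputable def resolventKernel (t : ℝ) (l : Ioi (0 : ℝ)) : ℝ := (1 + ((l : ℝ) - 1) * t)⁻¹

/-- Multiplication by `(1 + (λ - 1) q) / (1 + (λ - 1) c')` moves convex combinations of kernels with
parameters in `[0, c]` to convex combinations of kernels with parameters in `[0, c']`. -/
theorem mul_mem_convexHull_resolventKernel {c q c' : ℝ} (hcq : c ≤ q) (hqc : q ≤ c')
    (hc' : c' ≤ 1) {f : Ioi (0 : ℝ) → ℝ}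
    (hf : f ∈ convexHull ℝ (resolventKernel '' Icc 0 c)) :
    (fun l : Ioi (0 : ℝ) => f l * ((1 + ((l : ℝ) - 1) * q) / (1 + ((l : ℝ) - 1) * c'))) ∈
      convexHull ℝ (resolventKernel '' Icc 0 c') := by
  let T : (Ioi (0 : ℝ) → ℝ) →ₗ[ℝ] (Ioi (0 : ℝ) → ℝ) :=
    { toFun := fun f l => f l * ((1 + ((l : ℝ) - 1) * q) / (1 + ((l : ℝ) - 1) * c'))
      map_add' := fun f g => by ext l; simp [add_mul]
      map_smul' := fun r f => by ext l; simp [mul_assoc] }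
  have key : convexHull ℝ (resolventKernel '' Icc 0 c) ⊆
      T ⁻¹' convexHull ℝ (resolventKernel '' Icc 0 c') := by
    refine convexHull_min ?_ ((convex_convexHull ℝ _).linear_preimage T)
    rintro _ ⟨t, ⟨ht0, htc⟩, rfl⟩
    have hmem : ∀ s ∈ Icc 0 c', resolventKernel s ∈ convexHull ℝ (resolventKernel '' Icc 0 c') :=
      fun s hs => subset_convexHull ℝ _ (mem_image_of_mem _ hs)
    have htc' : t ≤ c' := htc.trans (hcq.trans hqc)
    -- When `t = c'` the partial fractions below would have a double pole, but then `q = c'` too and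
    -- the multiplier is `1`.
    rcases htc'.eq_or_lt with h | h
    · have hq : q = c' := by linarith
      have : T (resolventKernel t) = resolventKernel t := by
        ext l
        have := one_add_mul_pos l.2 ⟨ht0.trans htc', hc'⟩
        simp [T, hq, div_self this.ne']
      rw [mem_preimage, this]
      exact hmem t ⟨ht0, htc'⟩
    · have hd : 0 < c' - t := sub_pos.2 h
      -- Partial fractions in `λ`. The weights sum to `1` and are nonnegative because `t ≤ c ≤ q ≤
      -- c'`.
      have : T (resolventKernel t) =
          ((q - t) / (c' - t)) • resolventKernel t + ((c' - q) / (c' - t)) • resolventKernel c' := by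
        ext l
        have h1 := one_add_mul_pos l.2 ⟨ht0.trans htc', hc'⟩
        have h2 := one_add_mul_pos l.2 ⟨ht0, htc'.trans hc'⟩
        simp only [T, LinearMap.coe_mk, AddHom.coe_mk, Pi.add_apply, Pi.smul_apply, smul_eq_mul,
          resolventKernel]
        field_simp
        ring
      rw [mem_preimage, this]
      refine convex_convexHull ℝ _ (hmem t ⟨ht0, htc'⟩) (hmem c' ⟨ht0.trans htc', le_rfl⟩)
        (div_nonneg (by linarith) hd.le) (div_nonneg (by linarith) hd.le) ?_
      field_simp
      ring
  exact key hf

/-- Induction on the number of factors, starting from the constant `1`, which is the kernel at `t =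
0 = a 0`. The interlacing `a k ≤ q k ≤ a (k + 1)` is what each multiplication step needs. -/
theorem prod_mem_convexHull_resolventKernel {a q : ℕ → ℝ} (n : ℕ) (h0 : a 0 = 0)
    (haq : ∀ k < n, a k ≤ q k) (hqa : ∀ k < n, q k ≤ a (k + 1)) (ha : ∀ k ≤ n, a k ≤ 1) :
    (fun l : Ioi (0 : ℝ) => ∏ k ∈ Finset.range n,
      ((1 + ((l : ℝ) - 1) * q k) / (1 + ((l : ℝ) - 1) * a (k + 1)))) ∈
      convexHull ℝ (resolventKernel '' Icc 0 (a n)) := by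
  induction n with
  | zero =>
    refine subset_convexHull ℝ _ ⟨0, ⟨le_rfl, h0.ge⟩, ?_⟩
    ext l
    simp [resolventKernel]
  | succ n ih =>
    simp only [Finset.prod_range_succ]
    exact mul_mem_convexHull_resolventKernel (haq n n.lt_succ_self) (hqa n n.lt_succ_self)
      (ha _ le_rfl) (ih (fun k hk => haq k (hk.trans n.lt_succ_self))
        (fun k hk => hqa k (hk.trans n.lt_succ_self)) fun k hk => ha k (hk.trans n.le_succ))

/-! ### Compactness and convexity of the set of mixtures -/

theorem continuous_resolventKernel_Icc (l : Ioi (0 : ℝ)) :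
    Continuous fun t : Icc (0 : ℝ) 1 => resolventKernel t l := by
  unfold resolventKernel
  exact Continuous.inv₀ (by fun_prop) fun t => (one_add_mul_pos l.2 t.2).ne'

/-- The mixtures of kernels by probability measures on `[0, 1]`. -/
def resolventMixtures : Set (Ioi (0 : ℝ) → ℝ) :=
  range fun (P : ProbabilityMeasure (Icc (0 : ℝ) 1)) (l : Ioi (0 : ℝ)) =>
    ∫ t : Icc (0 : ℝ) 1, resolventKernel t l ∂(P : Measure (Icc (0 : ℝ) 1))

/-- Probability measures on the compact space `[0,1]` form a weakly compact space, and each kernel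
is continuous in `t`, so the set is a compact image in the topology of pointwise convergence. -/
theorem isClosed_resolventMixtures : IsClosed resolventMixtures := by
  refine (isCompact_range (continuous_pi fun l => ?_)).isClosed
  exact ProbabilityMeasure.continuous_integral_boundedContinuousFunction
    (BoundedContinuousFunction.mkOfCompact ⟨_, continuous_resolventKernel_Icc l⟩)

theorem integrable_resolventKernel (P : Measure (Icc (0 : ℝ) 1)) [IsFiniteMeasure P]
    (l : Ioi (0 : ℝ)) : Integrable (fun t : Icc (0 : ℝ) 1 => resolventKernel t l) P :=
  (BoundedContinuousFunction.mkOfCompact ⟨_, continuous_resolventKernel_Icc l⟩).integrable P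

theorem convex_resolventMixtures : Convex ℝ resolventMixtures := by
  rintro _ ⟨P, rfl⟩ _ ⟨Q, rfl⟩ a b ha hb hab
  refine ⟨⟨ENNReal.ofReal a • (P : Measure _) + ENNReal.ofReal b • (Q : Measure _), ⟨?_⟩⟩, ?_⟩
  · simp [← ENNReal.ofReal_add ha hb, hab]
  · ext l
    simp only [ProbabilityMeasure.coe_mk, Pi.add_apply, Pi.smul_apply, smul_eq_mul]
    rw [integral_add_measure
      ((integrable_resolventKernel _ l).smul_measure ENNReal.ofReal_ne_top)
      ((integrable_resolventKernel _ l).smul_measure ENNReal.ofReal_ne_top),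
      integral_smul_measure, integral_smul_measure]
    simp [ha, hb]

theorem convexHull_resolventKernel_subset :
    convexHull ℝ (resolventKernel '' Icc 0 1) ⊆ resolventMixtures := by
  refine convexHull_min ?_ convex_resolventMixtures
  rintro _ ⟨t, ht, rfl⟩
  refine ⟨⟨Measure.dirac ⟨t, ht⟩, inferInstance⟩, ?_⟩
  ext l
  simp

/-! ### Approximation by indicators of intervals -/

/-- Freezing `h` at `a` turns both integrals into `h a * ∫ β`. Each of the two replacements costs at
most `M * (b - a)`. -/
theorem abs_integral_sub_integral_mul_le {h β : ℝ → ℝ} {a b M : ℝ} (hab : a ≤ b)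
    (hh : ContinuousOn h (Icc a b)) (hM : ∀ x ∈ Icc a b, |h x - h a| ≤ M)
    (hβ : IntervalIntegrable β volume a b) (hβ01 : ∀ x, β x ∈ Icc (0 : ℝ) 1) :
    |(∫ x in a..(a + ∫ y in a..b, β y), h x) - ∫ x in a..b, h x * β x| ≤ 2 * (M * (b - a)) := by
  set c := ∫ y in a..b, β y with hc
  have hM0 : 0 ≤ M := (abs_nonneg _).trans (hM a ⟨le_rfl, hab⟩)
  have hc0 : 0 ≤ c := intervalIntegral.integral_nonneg hab fun x _ => (hβ01 x).1
  have hcb : c ≤ b - a := by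
    simpa using intervalIntegral.integral_mono_on hab hβ
      (intervalIntegrable_const (c := (1 : ℝ))) fun x _ => (hβ01 x).2
  have hsub : uIcc a (a + c) ⊆ Icc a b := by
    rw [uIcc_of_le (by linarith)]; exact Icc_subset_Icc_right (by linarith)
  have hint1 : IntervalIntegrable h volume a (a + c) := (hh.mono hsub).intervalIntegrable
  have hint2 : IntervalIntegrable (fun x => h x * β x) volume a b :=
    hβ.continuousOn_mul (by rwa [uIcc_of_le hab])
  have e1 : (∫ x in a..(a + c), h x) - c * h a = ∫ x in a..(a + c), (h x - h a) := by
    rw [intervalIntegral.integral_sub hint1 intervalIntegrable_const]; simp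
  have e2 : (∫ x in a..b, h x * β x) - c * h a = ∫ x in a..b, (h x - h a) * β x := by
    simp only [sub_mul]
    rw [intervalIntegral.integral_sub hint2 (hβ.const_mul _),
      intervalIntegral.integral_const_mul, mul_comm c]
  have b1 : |∫ x in a..(a + c), (h x - h a)| ≤ M * (b - a) := by
    rw [← Real.norm_eq_abs]
    refine (intervalIntegral.norm_integral_le_of_norm_le_const (C := M) fun x hx => ?_).trans ?_
    · exact hM x (hsub (uIoc_subset_uIcc hx))
    · rw [add_sub_cancel_left, abs_of_nonneg hc0]; gcongr
  have b2 : |∫ x in a..b, (h x - h a) * β x| ≤ M * (b - a) := by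
    rw [← Real.norm_eq_abs]
    refine (intervalIntegral.norm_integral_le_of_norm_le_const (C := M) fun x hx => ?_).trans ?_
    · rw [uIoc_of_le hab] at hx
      rw [Real.norm_eq_abs, abs_mul, abs_of_nonneg (hβ01 x).1]
      exact (mul_le_of_le_one_right (abs_nonneg _) (hβ01 x).2).trans (hM x (Ioc_subset_Icc_self hx))
    · rw [abs_of_nonneg (by linarith)]
  calc _ = |(∫ x in a..(a + c), (h x - h a)) - ∫ x in a..b, (h x - h a) * β x| := by
        rw [← e1, ← e2]; congr 1; ring
    _ ≤ _ := (abs_sub _ _).trans (by linarith)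

theorem exp_integral_resolvent {l a q : ℝ} (hl : 0 < l) (ha : a ∈ Icc (0 : ℝ) 1)
    (hq : q ∈ Icc (0 : ℝ) 1) :
    Real.exp (∫ x in a..q, (l - 1) / (1 + (l - 1) * x)) =
      (1 + (l - 1) * q) / (1 + (l - 1) * a) := by
  have hsub : uIcc a q ⊆ Icc 0 1 := uIcc_subset_Icc ha hq
  have hd : ∀ x ∈ uIcc a q, HasDerivAt (fun y => Real.log (1 + (l - 1) * y))
      ((l - 1) / (1 + (l - 1) * x)) x := fun x hx =>
    HasDerivAt.log (by simpa using ((hasDerivAt_id x).const_mul (l - 1)).const_add 1)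
      (one_add_mul_pos hl (hsub hx)).ne'
  rw [intervalIntegral.integral_eq_sub_of_hasDerivAt hd, Real.exp_sub,
    Real.exp_log (one_add_mul_pos hl hq), Real.exp_log (one_add_mul_pos hl ha)]
  refine ContinuousOn.intervalIntegrable ?_
  exact ContinuousOn.div (by fun_prop) (by fun_prop) fun x hx => (one_add_mul_pos hl (hsub hx)).ne'

theorem abs_resolvent_sub_le {l x y : ℝ} (hl : 0 < l) (hx : x ∈ Icc (0 : ℝ) 1)
    (hy : y ∈ Icc (0 : ℝ) 1) :
    |(l - 1) / (1 + (l - 1) * x) - (l - 1) / (1 + (l - 1) * y)| ≤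
      (l - 1) ^ 2 / (min l 1) ^ 2 * |x - y| := by
  have h1 := one_add_mul_pos hl hx
  have h2 := one_add_mul_pos hl hy
  have h0 : 0 < min l 1 := lt_min hl one_pos
  have e : (l - 1) / (1 + (l - 1) * x) - (l - 1) / (1 + (l - 1) * y) =
      (l - 1) ^ 2 / ((1 + (l - 1) * x) * (1 + (l - 1) * y)) * (y - x) := by
    field_simp
    ring
  rw [e, abs_mul, abs_sub_comm y x, abs_of_nonneg (by positivity), sq (min l 1)]
  gcongr
  · exact min_le_one_add_mul hx
  · exact min_le_one_add_mul hy

/-- Replacing `β` on each interval `[k/n, (k+1)/n]` by the indicator of an initial interval of the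
same mass approximates `exp ∫ (λ-1)/(1+(λ-1)x) β(x) dx`. -/
theorem tendsto_prod_resolvent {β : ℝ → ℝ} (hβ : IntervalIntegrable β volume 0 1)
    (hβ01 : ∀ x, β x ∈ Icc (0 : ℝ) 1) {l : ℝ} (hl : 0 < l) :
    Tendsto (fun n : ℕ => ∏ k ∈ Finset.range n,
      ((1 + (l - 1) * ((k : ℝ) / n + ∫ y in ((k : ℝ) / n)..(((k + 1 : ℕ) : ℝ) / n), β y)) /
        (1 + (l - 1) * (((k + 1 : ℕ) : ℝ) / n)))) atTop
      (𝓝 (Real.exp (∫ x in (0 : ℝ)..1, (l - 1) / (1 + (l - 1) * x) * β x) / l)) := by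
  set h : ℝ → ℝ := fun x => (l - 1) / (1 + (l - 1) * x) with hh
  set L := (l - 1) ^ 2 / (min l 1) ^ 2 with hL
  let q : ℕ → ℕ → ℝ := fun n k => (k : ℝ) / n + ∫ y in ((k : ℝ) / n)..(((k + 1 : ℕ) : ℝ) / n), β y
  have hcont : ContinuousOn h (Icc 0 1) :=
    ContinuousOn.div (by fun_prop) (by fun_prop) fun x hx => (one_add_mul_pos hl hx).ne'
  have hmem : ∀ n : ℕ, ∀ k ≤ n, (k : ℝ) / n ∈ Icc (0 : ℝ) 1 := fun n k hk =>
    ⟨by positivity, div_le_one_of_le₀ (by exact_mod_cast hk) (by positivity)⟩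
  have hstep : ∀ n k : ℕ, ((k + 1 : ℕ) : ℝ) / n - (k : ℝ) / n = 1 / n := fun n k => by
    push_cast; ring
  have hle : ∀ n k : ℕ, (k : ℝ) / n ≤ ((k + 1 : ℕ) : ℝ) / n := fun n k => by
    have : (0 : ℝ) ≤ 1 / n := by positivity
    linarith [hstep n k]
  have hβk : ∀ n k : ℕ, k < n →
      IntervalIntegrable β volume ((k : ℝ) / n) (((k + 1 : ℕ) : ℝ) / n) := fun n k hk =>
    hβ.mono_set (by
      rw [uIcc_of_le zero_le_one]; exact uIcc_subset_Icc (hmem n k hk.le) (hmem n _ hk))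
  have hqmem : ∀ n k : ℕ, k < n → q n k ∈ Icc (0 : ℝ) 1 := by
    intro n k hk
    have h0 : 0 ≤ ∫ y in ((k : ℝ) / n)..(((k + 1 : ℕ) : ℝ) / n), β y :=
      intervalIntegral.integral_nonneg (hle n k) fun x _ => (hβ01 x).1
    have h1 : ∫ y in ((k : ℝ) / n)..(((k + 1 : ℕ) : ℝ) / n), β y ≤
        ((k + 1 : ℕ) : ℝ) / n - (k : ℝ) / n := by
      simpa using intervalIntegral.integral_mono_on (hle n k) (hβk n k hk)
        (intervalIntegrable_const (c := (1 : ℝ))) fun x _ => (hβ01 x).2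
    have h2 := (hmem n _ hk).2
    exact ⟨add_nonneg (hmem n k hk.le).1 h0, by simp only [q]; linarith⟩
  have hprod : ∀ n : ℕ, 0 < n → ∏ k ∈ Finset.range n,
      ((1 + (l - 1) * q n k) / (1 + (l - 1) * (((k + 1 : ℕ) : ℝ) / n))) =
      Real.exp (∑ k ∈ Finset.range n, ∫ x in ((k : ℝ) / n)..(q n k), h x) / l := by
    intro n hn
    -- The quotients `(1+(l-1)q_k)/(1+(l-1)k/n)` are the exponentials of the integrals. Passing to
    -- the denominators at `(k+1)/n` costs this telescoping product, which equals `1/l` at `m = n`.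
    have htel : ∀ m ≤ n, ∏ k ∈ Finset.range m,
        ((1 + (l - 1) * ((k : ℝ) / n)) / (1 + (l - 1) * (((k + 1 : ℕ) : ℝ) / n))) =
        1 / (1 + (l - 1) * ((m : ℝ) / n)) := by
      intro m
      induction m with
      | zero => simp
      | succ m ih =>
        intro hm
        rw [Finset.prod_range_succ, ih (by lia),
          div_mul_div_cancel₀ (one_add_mul_pos hl (hmem n m (by lia))).ne']
    have htel := htel n le_rfl
    rw [div_self (by positivity), mul_one, add_sub_cancel] at htel
    rw [Real.exp_sum, div_eq_mul_one_div, ← htel, ← Finset.prod_mul_distrib]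
    refine Finset.prod_congr rfl fun k hk => ?_
    have hk := Finset.mem_range.1 hk
    rw [exp_integral_resolvent hl (hmem n k hk.le) (hqmem n k hk),
      div_mul_div_cancel₀ (one_add_mul_pos hl (hmem n k hk.le)).ne']
  -- `L` is a Lipschitz constant of `h` on `[0,1]`, so `h` oscillates by at most `L/n` on each cell.
  -- The `n` cells contribute errors `2 * (L/n) * (1/n)`.
  have hbound : ∀ n : ℕ, 0 < n →
      |(∑ k ∈ Finset.range n, ∫ x in ((k : ℝ) / n)..(q n k), h x) -
        ∫ x in (0 : ℝ)..1, h x * β x| ≤ 2 * L * (1 / (n : ℝ)) := by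
    intro n hn
    have hn' : (n : ℝ) ≠ 0 := by positivity
    have hsum : ∫ x in (0 : ℝ)..1, h x * β x = ∑ k ∈ Finset.range n,
        ∫ x in ((k : ℝ) / n)..(((k + 1 : ℕ) : ℝ) / n), h x * β x := by
      rw [intervalIntegral.sum_integral_adjacent_intervals (a := fun k : ℕ => (k : ℝ) / n)]
      · simp [div_self hn']
      · intro k hk
        refine (hβk n k hk).continuousOn_mul (hcont.mono ?_)
        exact uIcc_subset_Icc (hmem n k hk.le) (hmem n _ hk)
    rw [hsum, ← Finset.sum_sub_distrib]
    calc _ ≤ ∑ k ∈ Finset.range n, 2 * (L * (1 / n) * (1 / n)) := by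
          refine (Finset.abs_sum_le_sum_abs _ _).trans (Finset.sum_le_sum fun k hk => ?_)
          have hk := Finset.mem_range.1 hk
          have hs : Icc ((k : ℝ) / n) (((k + 1 : ℕ) : ℝ) / n) ⊆ Icc 0 1 :=
            Icc_subset_Icc (hmem n k hk.le).1 (hmem n _ hk).2
          have := abs_integral_sub_integral_mul_le (M := L * (1 / n)) (hle n k) (hcont.mono hs)
            (fun x hx => (abs_resolvent_sub_le hl (hs hx) (hmem n k hk.le)).trans (by
              rw [abs_of_nonneg (sub_nonneg.2 hx.1), ← hstep n k]
              gcongr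
              exact hx.2)) (hβk n k hk) hβ01
          rwa [hstep n k] at this
      _ = _ := by
          rw [Finset.sum_const, Finset.card_range, nsmul_eq_mul]
          field_simp
  have hlim : Tendsto (fun n : ℕ => ∑ k ∈ Finset.range n, ∫ x in ((k : ℝ) / n)..(q n k), h x)
      atTop (𝓝 (∫ x in (0 : ℝ)..1, h x * β x)) := by
    rw [tendsto_iff_norm_sub_tendsto_zero]
    refine squeeze_zero' (Eventually.of_forall fun _ => norm_nonneg _)
      ((eventually_gt_atTop 0).mono fun n hn => hbound n hn) ?_
    simpa using tendsto_one_div_atTop_nhds_zero_nat.const_mul (2 * L)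
  refine Tendsto.congr' ((eventually_gt_atTop 0).mono fun n hn => (hprod n hn).symm) ?_
  exact ((Real.continuous_exp.tendsto _).comp hlim).div_const l

/-! ### Passage to the limit and the mixture representation -/

theorem exp_integral_div_mem_resolventMixtures {β : ℝ → ℝ}
    (hβ : IntervalIntegrable β volume 0 1) (hβ01 : ∀ x, β x ∈ Icc (0 : ℝ) 1) :
    (fun l : Ioi (0 : ℝ) =>
      Real.exp (∫ x in (0 : ℝ)..1, ((l : ℝ) - 1) / (1 + ((l : ℝ) - 1) * x) * β x) / (l : ℝ)) ∈
      resolventMixtures := by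
  refine isClosed_resolventMixtures.mem_of_tendsto (tendsto_pi_nhds.2 fun l =>
    tendsto_prod_resolvent hβ hβ01 l.2) ((eventually_gt_atTop 0).mono fun n hn => ?_)
  have hle : ∀ k : ℕ, (k : ℝ) / n ≤ ((k + 1 : ℕ) : ℝ) / n := fun k => by gcongr; simp
  have h1 : ∀ k ≤ n, (k : ℝ) / n ≤ 1 := fun k hk =>
    div_le_one_of_le₀ (by exact_mod_cast hk) (by positivity)
  have := prod_mem_convexHull_resolventKernel (a := fun k : ℕ => (k : ℝ) / n)
    (q := fun k : ℕ => (k : ℝ) / n + ∫ y in ((k : ℝ) / n)..(((k + 1 : ℕ) : ℝ) / n), β y) n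
    (by simp)
    (fun k _ => le_add_of_nonneg_right
      (intervalIntegral.integral_nonneg (hle k) fun x _ => (hβ01 x).1))
    (fun k hk => by
      have hβk : IntervalIntegrable β volume ((k : ℝ) / n) (((k + 1 : ℕ) : ℝ) / n) :=
        hβ.mono_set (by
          rw [uIcc_of_le zero_le_one]
          exact uIcc_subset_Icc ⟨by positivity, h1 k hk.le⟩ ⟨by positivity, h1 _ hk⟩)
      have : ∫ y in ((k : ℝ) / n)..(((k + 1 : ℕ) : ℝ) / n), β y ≤
          ((k + 1 : ℕ) : ℝ) / n - (k : ℝ) / n := by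
        simpa using intervalIntegral.integral_mono_on (hle k) hβk
          (intervalIntegrable_const (c := (1 : ℝ))) fun x _ => (hβ01 x).2
      linarith)
    h1
  refine convexHull_resolventKernel_subset (convexHull_mono (image_mono ?_) this)
  exact Icc_subset_Icc_right (h1 n le_rfl)

theorem exists_marchalPhi_eq_integral (α : Icc (0 : ℝ) 1 → Icc (0 : ℝ) 1)
    (hα : AEMeasurable α volume) :
    ∃ P : ProbabilityMeasure (Icc (0 : ℝ) 1), ∀ l ∈ Ioi (0 : ℝ),
      marchalPhi α l = ∫ t : Icc (0 : ℝ) 1, l / (1 + (l - 1) * (t : ℝ)) ∂(P : Measure _) := by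
  -- Extending by `projIcc` keeps the values in `[0,1]` on all of `ℝ`, as the interval integral
  -- lemmas require.
  let β : ℝ → ℝ := fun x => α (projIcc 0 1 zero_le_one x)
  have hβ01 : ∀ x, β x ∈ Icc (0 : ℝ) 1 := fun x => (α _).2
  have hβα : ∀ x : Icc (0 : ℝ) 1, β x = α x := fun x => by simp [β]
  have hβm : AEMeasurable β (volume.restrict (Icc 0 1)) := by
    have := map_comap_subtype_coe (measurableSet_Icc (a := (0 : ℝ)) (b := 1)) volume
    rw [← this, (MeasurableEmbedding.subtype_coe measurableSet_Icc).aemeasurable_map_iff]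
    refine (measurable_subtype_coe.comp_aemeasurable hα).congr (ae_of_all _ fun x => ?_)
    exact (hβα x).symm
  have hβ : IntervalIntegrable β volume 0 1 := by
    rw [intervalIntegrable_iff_integrableOn_Icc_of_le zero_le_one]
    refine Integrable.of_bound hβm.aestronglyMeasurable 1 (ae_of_all _ fun x => ?_)
    rw [Real.norm_eq_abs, abs_of_nonneg (hβ01 x).1]
    exact (hβ01 x).2
  obtain ⟨P, hP⟩ := exp_integral_div_mem_resolventMixtures hβ hβ01
  refine ⟨P, fun l hl => ?_⟩
  have hl0 : l ≠ 0 := (mem_Ioi.1 hl).ne'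
  have h := congrFun hP ⟨l, hl⟩
  have hphi : marchalPhi α l =
      Real.exp (∫ x in (0 : ℝ)..1, (l - 1) / (1 + (l - 1) * x) * β x) := by
    rw [intervalIntegral.integral_of_le zero_le_one, ← integral_Icc_eq_integral_Ioc,
      ← integral_subtype_comap measurableSet_Icc]
    unfold marchalPhi
    congr 1
    refine integral_congr_ae (ae_of_all _ fun x => ?_)
    simp only [hβα]
  rw [hphi]
  simp only [resolventKernel] at h
  simp only [div_eq_mul_inv l, integral_const_mul, h]
  field_simp

/-! ### Differentiation under the integral sign to every order -/

section ParametricIntegral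

variable {X : Type*} [MeasurableSpace X] {P : Measure X} [IsFiniteMeasure P] {F : ℕ → ℝ → X → ℝ}

theorem integrable_of_bound_on_Icc (hm : ∀ k x, 0 < x → AEStronglyMeasurable (F k x) P)
    (hb : ∀ k δ M, 0 < δ → ∃ C, ∀ x ∈ Icc δ M, ∀ t, |F k x t| ≤ C) {x : ℝ} (hx : 0 < x) (k : ℕ) :
    Integrable (F k x) P := by
  obtain ⟨C, hC⟩ := hb k x x hx
  exact Integrable.of_bound (hm k x hx) C (ae_of_all _ fun t => hC x ⟨le_rfl, le_rfl⟩ t)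

theorem hasDerivAt_integral_of_bound_on_Icc
    (hm : ∀ k x, 0 < x → AEStronglyMeasurable (F k x) P)
    (hd : ∀ k x t, 0 < x → HasDerivAt (fun y => F k y t) (F (k + 1) x t) x)
    (hb : ∀ k δ M, 0 < δ → ∃ C, ∀ x ∈ Icc δ M, ∀ t, |F k x t| ≤ C)
    {x : ℝ} (hx : 0 < x) (k : ℕ) :
    HasDerivAt (fun y => ∫ t, F k y t ∂P) (∫ t, F (k + 1) x t ∂P) x := by
  -- Bounds are available only away from `0`. The neighbourhood `[x/2, 2x]` suffices, and a constant
  -- dominates since `P` is finite.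
  obtain ⟨C, hC⟩ := hb (k + 1) (x / 2) (2 * x) (half_pos hx)
  have hpos : ∀ y ∈ Icc (x / 2) (2 * x), 0 < y := fun y hy => (half_pos hx).trans_le hy.1
  exact (hasDerivAt_integral_of_dominated_loc_of_deriv_le (bound := fun _ => C)
    (Icc_mem_nhds (half_lt_self hx) (by linarith))
    ((eventually_gt_nhds hx).mono fun y hy => hm k y hy)
    (integrable_of_bound_on_Icc hm hb hx k) (hm (k + 1) x hx)
    (ae_of_all _ fun t y hy => hC y hy t) (integrable_const C)
    (ae_of_all _ fun t y hy => hd k y t (hpos y hy))).2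

theorem iteratedDerivWithin_integral_of_bound_on_Icc
    (hm : ∀ k x, 0 < x → AEStronglyMeasurable (F k x) P)
    (hd : ∀ k x t, 0 < x → HasDerivAt (fun y => F k y t) (F (k + 1) x t) x)
    (hb : ∀ k δ M, 0 < δ → ∃ C, ∀ x ∈ Icc δ M, ∀ t, |F k x t| ≤ C) (k : ℕ) :
    EqOn (iteratedDerivWithin k (fun y => ∫ t, F 0 y t ∂P) (Ioi 0))
      (fun x => ∫ t, F k x t ∂P) (Ioi 0) := by
  induction k with
  | zero => intro x _; simp
  | succ k ih =>
    intro x hx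
    rw [iteratedDerivWithin_succ, derivWithin_congr ih (ih hx)]
    exact (hasDerivAt_integral_of_bound_on_Icc hm hd hb hx k).hasDerivWithinAt.derivWithin
      (uniqueDiffOn_Ioi 0 x hx)

theorem contDiffOn_integral_of_bound_on_Icc
    (hm : ∀ k x, 0 < x → AEStronglyMeasurable (F k x) P)
    (hd : ∀ k x t, 0 < x → HasDerivAt (fun y => F k y t) (F (k + 1) x t) x)
    (hb : ∀ k δ M, 0 < δ → ∃ C, ∀ x ∈ Icc δ M, ∀ t, |F k x t| ≤ C) :
    ContDiffOn ℝ ∞ (fun y => ∫ t, F 0 y t ∂P) (Ioi 0) := by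
  refine contDiffOn_of_differentiableOn_deriv fun k _ => ?_
  refine DifferentiableOn.congr (f := fun x => ∫ t, F k x t ∂P) (fun x hx => ?_)
    (iteratedDerivWithin_integral_of_bound_on_Icc hm hd hb k)
  exact (hasDerivAt_integral_of_bound_on_Icc hm hd hb hx k).differentiableAt.differentiableWithinAt

end ParametricIntegral

/-! ### The Bernstein property of mixtures -/

/-- The `k`-th derivative in `l` of `l / (1 + (l - 1) t)`. -/
noncomputable def mobiusDeriv : ℕ → ℝ → Icc (0 : ℝ) 1 → ℝ
  | 0, l, t => l / (1 + (l - 1) * t)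
  | k + 1, l, t => (-1) ^ k * ((k + 1).factorial : ℝ) * (t : ℝ) ^ k * (1 - t) *
      ((1 + (l - 1) * t) ^ (k + 2))⁻¹

theorem hasDerivAt_mobiusDeriv (k : ℕ) {l : ℝ} (t : Icc (0 : ℝ) 1) (hl : 0 < l) :
    HasDerivAt (fun y => mobiusDeriv k y t) (mobiusDeriv (k + 1) l t) l := by
  have hp := (one_add_mul_pos hl t.2).ne'
  have h1 : HasDerivAt (fun y : ℝ => 1 + (y - 1) * (t : ℝ)) (t : ℝ) l := by
    simpa using (((hasDerivAt_id l).sub_const 1).mul_const (t : ℝ)).const_add 1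
  cases k with
  | zero =>
    refine ((hasDerivAt_id l).div h1 hp).congr_deriv ?_
    simp only [mobiusDeriv, id]
    simp
    field_simp
    ring
  | succ k =>
    refine (((h1.fun_pow (k + 2)).fun_inv (pow_ne_zero _ hp)).const_mul _).congr_deriv ?_
    simp only [mobiusDeriv, Nat.factorial_succ (k + 1)]
    rw [show k + 2 - 1 = k + 1 from rfl]
    push_cast
    generalize 1 + (l - 1) * (t : ℝ) = p at hp
    field_simp
    ring

theorem measurable_mobiusDeriv (k : ℕ) (l : ℝ) : Measurable (mobiusDeriv k l) := by
  cases k <;> unfold mobiusDeriv <;> fun_prop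

theorem exists_bound_mobiusDeriv (k : ℕ) {δ : ℝ} (M : ℝ) (hδ : 0 < δ) :
    ∃ C, ∀ x ∈ Icc δ M, ∀ t, |mobiusDeriv k x t| ≤ C := by
  have hm : 0 < min δ 1 := lt_min hδ one_pos
  have hle : ∀ x ∈ Icc δ M, ∀ t : Icc (0 : ℝ) 1, min δ 1 ≤ 1 + (x - 1) * t := fun x hx t =>
    (min_le_min_right 1 hx.1).trans (min_le_one_add_mul t.2)
  cases k with
  | zero =>
    refine ⟨M / min δ 1, fun x hx t => ?_⟩
    have hx0 := hδ.trans_le hx.1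
    have := one_add_mul_pos hx0 t.2
    rw [mobiusDeriv, abs_of_nonneg (by positivity)]
    exact div_le_div₀ (hx0.le.trans hx.2) hx.2 hm (hle x hx t)
  | succ k =>
    refine ⟨(k + 1).factorial * 1 * 1 * ((min δ 1) ^ (k + 2))⁻¹, fun x hx t => ?_⟩
    have hx0 := hδ.trans_le hx.1
    have := one_add_mul_pos hx0 t.2
    have h0 := t.2.1
    have h1 : 0 ≤ 1 - (t : ℝ) := sub_nonneg.2 t.2.2
    rw [mobiusDeriv, abs_mul, abs_mul, abs_mul, abs_mul, abs_pow, abs_neg, abs_one, one_pow,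
      one_mul, Nat.abs_cast, abs_of_nonneg h1, abs_of_nonneg (pow_nonneg h0 k),
      abs_of_nonneg (by positivity)]
    gcongr
    · exact pow_le_one₀ h0 t.2.2
    · linarith
    · exact hle x hx t

theorem mobiusDeriv_sign (k : ℕ) {l : ℝ} (hl : 0 < l) (t : Icc (0 : ℝ) 1) :
    0 ≤ (-1) ^ k * mobiusDeriv (k + 1) l t := by
  have := one_add_mul_pos hl t.2
  have h0 := t.2.1
  have h1 : 0 ≤ 1 - (t : ℝ) := sub_nonneg.2 t.2.2
  rw [mobiusDeriv]
  simp only [← mul_assoc, ← mul_pow]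
  norm_num
  positivity

theorem isBernstein_integral_mobius (P : Measure (Icc (0 : ℝ) 1)) [IsFiniteMeasure P] {f : ℝ → ℝ}
    (hf : ∀ l ∈ Ioi (0 : ℝ), f l = ∫ t : Icc (0 : ℝ) 1, l / (1 + (l - 1) * (t : ℝ)) ∂P) :
    IsBernstein f := by
  have hm : ∀ k x, 0 < x → AEStronglyMeasurable (mobiusDeriv k x) P := fun k x _ =>
    (measurable_mobiusDeriv k x).aestronglyMeasurable
  have hd : ∀ k x t, 0 < x →
      HasDerivAt (fun y => mobiusDeriv k y t) (mobiusDeriv (k + 1) x t) x :=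
    fun k x t hx => hasDerivAt_mobiusDeriv k t hx
  have hb : ∀ k δ M, 0 < δ → ∃ C, ∀ x ∈ Icc δ M, ∀ t, |mobiusDeriv k x t| ≤ C :=
    fun k δ M hδ => exists_bound_mobiusDeriv k M hδ
  have hf' : EqOn f (fun l => ∫ t, mobiusDeriv 0 l t ∂P) (Ioi 0) := hf
  refine ⟨fun l hl => ?_, (contDiffOn_integral_of_bound_on_Icc hm hd hb).congr hf',
    fun k hk l hl => ?_⟩
  · rw [hf l hl]
    exact integral_nonneg fun t => div_nonneg (mem_Ioi.1 hl).le (one_add_mul_pos hl t.2).le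
  · obtain ⟨k, rfl⟩ := Nat.exists_eq_add_of_le' hk
    rw [iteratedDerivWithin_congr hf' hl,
      iteratedDerivWithin_integral_of_bound_on_Icc hm hd hb (k + 1) hl, Nat.add_sub_cancel,
      ← integral_const_mul]
    exact integral_nonneg fun t => mobiusDeriv_sign k hl t

/-! ### The Lévy density and its complete monotonicity -/

/-- The `k`-th derivative in `x` of `(s + 1) s e^{-s x}`, where `s = (1 - t) / t`. -/
noncomputable def levyDensityDeriv (k : ℕ) (x : ℝ) (t : Icc (0 : ℝ) 1) : ℝ :=
  (-1) ^ k * (((1 - (t : ℝ)) / t + 1) * ((1 - (t : ℝ)) / t) ^ (k + 1)) *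
    Real.exp (-((1 - (t : ℝ)) / t * x))

/-- Valid at `t = 0` as well: division by zero makes `s = 0` there, so the density kernel vanishes
at both endpoints. -/
theorem one_sub_div_nonneg (t : Icc (0 : ℝ) 1) : 0 ≤ (1 - (t : ℝ)) / t :=
  div_nonneg (sub_nonneg.2 t.2.2) t.2.1

theorem hasDerivAt_levyDensityDeriv (k : ℕ) (x : ℝ) (t : Icc (0 : ℝ) 1) :
    HasDerivAt (fun y => levyDensityDeriv k y t) (levyDensityDeriv (k + 1) x t) x := by
  unfold levyDensityDeriv
  have h : HasDerivAt (fun y : ℝ => -((1 - (t : ℝ)) / t * y)) (-((1 - (t : ℝ)) / t)) x := by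
    simpa using ((hasDerivAt_id x).const_mul ((1 - (t : ℝ)) / t)).fun_neg
  refine (h.exp.const_mul _).congr_deriv ?_
  ring

theorem measurable_levyDensityDeriv (k : ℕ) :
    Measurable (Function.uncurry (levyDensityDeriv k)) := by
  unfold levyDensityDeriv Function.uncurry
  fun_prop

theorem levyDensityDeriv_sign (k : ℕ) (x : ℝ) (t : Icc (0 : ℝ) 1) :
    0 ≤ (-1) ^ k * levyDensityDeriv k x t := by
  have := one_sub_div_nonneg t
  rw [levyDensityDeriv]
  simp only [← mul_assoc, ← mul_pow]
  norm_num
  positivity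

/-- Since `s` is unbounded as `t → 0`, the power of `s` must be absorbed by the exponential:
`(s+1)^(k+2)` is at most a constant times `e^{δ(s+1)}`, and `e^{-sδ}` cancels all of this but `e^δ`.
-/
theorem exists_bound_levyDensityDeriv (k : ℕ) {δ : ℝ} (M : ℝ) (hδ : 0 < δ) :
    ∃ C, ∀ x ∈ Icc δ M, ∀ t, |levyDensityDeriv k x t| ≤ C := by
  refine ⟨(k + 2).factorial / δ ^ (k + 2) * Real.exp δ, fun x hx t => ?_⟩
  have hs := one_sub_div_nonneg t
  rw [levyDensityDeriv]
  set s := (1 - (t : ℝ)) / t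
  have h1 : (s + 1) * s ^ (k + 1) ≤ (s + 1) ^ (k + 2) := by
    rw [pow_succ' (s + 1) (k + 1)]
    gcongr
    linarith
  have h2 := Real.pow_div_factorial_le_exp (x := δ * (s + 1)) (by positivity) (k + 2)
  have h3 : (s + 1) ^ (k + 2) ≤ (k + 2).factorial / δ ^ (k + 2) * Real.exp (δ * (s + 1)) := by
    rw [mul_pow] at h2
    field_simp at h2 ⊢
    linarith
  rw [abs_mul, abs_mul, abs_pow, abs_neg, abs_one, one_pow, one_mul, abs_of_nonneg (by positivity),
    Real.abs_exp]
  calc _ ≤ (k + 2).factorial / δ ^ (k + 2) * Real.exp (δ * (s + 1)) * Real.exp (-(s * δ)) := by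
        have := hx.1
        exact mul_le_mul (h1.trans h3) (Real.exp_le_exp.2 (by gcongr)) (Real.exp_pos _).le
          (by positivity)
    _ = _ := by rw [mul_assoc, ← Real.exp_add]; congr 2; ring

/-- The density `x ↦ ∫ (s + 1) s e^{-s x} P(dt)`, where `s = (1 - t) / t`. -/
noncomputable def levyDensity (P : Measure (Icc (0 : ℝ) 1)) (x : ℝ) : ℝ :=
  ∫ t, levyDensityDeriv 0 x t ∂P

theorem isCompletelyMonotone_levyDensity (P : Measure (Icc (0 : ℝ) 1)) [IsFiniteMeasure P] :
    IsCompletelyMonotone (levyDensity P) := by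
  have hm : ∀ k x, 0 < x → AEStronglyMeasurable (levyDensityDeriv k x) P := fun k x _ =>
    ((measurable_levyDensityDeriv k).of_uncurry_left (x := x)).aestronglyMeasurable
  have hd : ∀ k x t, 0 < x →
      HasDerivAt (fun y => levyDensityDeriv k y t) (levyDensityDeriv (k + 1) x t) x :=
    fun k x t _ => hasDerivAt_levyDensityDeriv k x t
  have hb : ∀ k δ M, 0 < δ → ∃ C, ∀ x ∈ Icc δ M, ∀ t, |levyDensityDeriv k x t| ≤ C :=
    fun k δ M hδ => exists_bound_levyDensityDeriv k M hδ
  refine ⟨contDiffOn_integral_of_bound_on_Icc hm hd hb, fun k x hx => ?_⟩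
  have := iteratedDerivWithin_integral_of_bound_on_Icc hm hd hb k hx
  unfold levyDensity
  rw [this, ← integral_const_mul]
  exact integral_nonneg fun t => levyDensityDeriv_sign k x t

theorem ofReal_levyDensity (P : Measure (Icc (0 : ℝ) 1)) [IsFiniteMeasure P] {x : ℝ} (hx : 0 < x) :
    ENNReal.ofReal (levyDensity P x) = ∫⁻ t, ENNReal.ofReal (levyDensityDeriv 0 x t) ∂P := by
  obtain ⟨C, hC⟩ := exists_bound_levyDensityDeriv 0 x hx
  refine ofReal_integral_eq_lintegral_ofReal (Integrable.of_bound
    ((measurable_levyDensityDeriv 0).of_uncurry_left (x := x)).aestronglyMeasurable C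
    (ae_of_all _ fun t => hC x ⟨le_rfl, le_rfl⟩ t)) (ae_of_all _ fun t => ?_)
  simpa using levyDensityDeriv_sign 0 x t

/-! ### The Lévy–Khintchine representation -/

/-- The kernel `l / (1 + (l - 1) t)` with its values at `t = 0` and `t = 1` replaced by `0`. -/
noncomputable def mobiusInterior (l : ℝ) (t : Icc (0 : ℝ) 1) : ℝ :=
  l / (1 + (l - 1) * (t : ℝ)) - (({1} : Set (Icc (0 : ℝ) 1)).indicator (fun _ => (1 : ℝ)) t +
    l * ({0} : Set (Icc (0 : ℝ) 1)).indicator (fun _ => (1 : ℝ)) t)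

theorem mobiusInterior_nonneg {l : ℝ} (hl : 0 < l) (t : Icc (0 : ℝ) 1) :
    0 ≤ mobiusInterior l t := by
  by_cases h0 : t = 0
  · subst h0; simp [mobiusInterior]
  by_cases h1 : t = 1
  · subst h1; simp [mobiusInterior, hl.ne']
  have := one_add_mul_pos hl t.2
  simp only [mobiusInterior, mem_singleton_iff, h0, h1, not_false_eq_true, indicator_of_notMem,
    mul_zero, add_zero, sub_zero]
  positivity

theorem integrable_mobiusInterior_and_integral_eq (P : Measure (Icc (0 : ℝ) 1)) [IsFiniteMeasure P]
    {l : ℝ} (hl : 0 < l) :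
    Integrable (mobiusInterior l) P ∧ ∫ t, mobiusInterior l t ∂P =
      (∫ t : Icc (0 : ℝ) 1, l / (1 + (l - 1) * (t : ℝ)) ∂P) - (P.real {1} + l * P.real {0}) := by
  have hint : Integrable (fun t : Icc (0 : ℝ) 1 => l / (1 + (l - 1) * (t : ℝ))) P := by
    obtain ⟨C, hC⟩ := exists_bound_mobiusDeriv 0 l hl
    exact Integrable.of_bound (measurable_mobiusDeriv 0 l).aestronglyMeasurable C
      (ae_of_all _ fun t => hC l ⟨le_rfl, le_rfl⟩ t)
  have hi1 : ∀ c : Icc (0 : ℝ) 1,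
      Integrable (({c} : Set (Icc (0 : ℝ) 1)).indicator (fun _ => (1 : ℝ))) P := fun c =>
    (integrable_const _).indicator (measurableSet_singleton c)
  refine ⟨hint.sub ((hi1 1).add ((hi1 0).const_mul l)), ?_⟩
  unfold mobiusInterior
  have h2 : ∫ t, (({1} : Set (Icc (0 : ℝ) 1)).indicator (fun _ => (1 : ℝ)) t +
      l * ({0} : Set (Icc (0 : ℝ) 1)).indicator (fun _ => (1 : ℝ)) t) ∂P =
      P.real {1} + l * P.real {0} := by
    rw [integral_add (hi1 1) ((hi1 0).const_mul l), integral_const_mul,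
      integral_indicator_const _ (measurableSet_singleton _),
      integral_indicator_const _ (measurableSet_singleton _)]
    simp
  rw [← h2]
  exact integral_sub hint ((hi1 1).add ((hi1 0).const_mul l))

/-- For `0 < t < 1` this is `(s+1)s(1/s - 1/(s+l)) = (s+1)l/(s+l)`, where `1 + (l-1)t = t(s+l)` and
`s + 1 = 1/t`. At the endpoints both sides are `0`. -/
theorem lintegral_one_sub_exp_mul_levyDensityDeriv {l : ℝ} (hl : 0 < l) (t : Icc (0 : ℝ) 1) :
    ∫⁻ x in Ioi (0 : ℝ), ENNReal.ofReal ((1 - Real.exp (-(l * x))) * levyDensityDeriv 0 x t) =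
      ENNReal.ofReal (mobiusInterior l t) := by
  by_cases h0 : t = 0
  · subst h0; simp [levyDensityDeriv, mobiusInterior]
  by_cases h1 : t = 1
  · subst h1; simp [levyDensityDeriv, mobiusInterior, hl.ne']
  have ht0 : 0 < (t : ℝ) := lt_of_le_of_ne t.2.1 fun h => h0 (Subtype.ext h.symm)
  have ht1 : (t : ℝ) < 1 := lt_of_le_of_ne t.2.2 fun h => h1 (Subtype.ext h)
  have hs : 0 < (1 - (t : ℝ)) / t := div_pos (sub_pos.2 ht1) ht0
  have hp := one_add_mul_pos hl t.2
  have hsl : 0 < (1 - (t : ℝ)) / t + l := by positivity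
  have hi := exp_neg_integrableOn_Ioi 0 hs
  have hi' := exp_neg_integrableOn_Ioi 0 hsl
  have e : ∀ x, (1 - Real.exp (-(l * x))) * levyDensityDeriv 0 x t =
      ((1 - (t : ℝ)) / t + 1) * ((1 - (t : ℝ)) / t) *
        (Real.exp (-((1 - (t : ℝ)) / t) * x) - Real.exp (-((1 - (t : ℝ)) / t + l) * x)) := by
    intro x
    have : Real.exp (-((1 - (t : ℝ)) / t + l) * x) =
        Real.exp (-(l * x)) * Real.exp (-((1 - (t : ℝ)) / t) * x) := by
      rw [← Real.exp_add]; congr 1; ring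
    rw [this, levyDensityDeriv, neg_mul]
    ring
  rw [← ofReal_integral_eq_lintegral_ofReal]
  · congr 1
    simp only [e]
    rw [integral_const_mul, integral_sub hi hi', integral_exp_mul_Ioi (by linarith),
      integral_exp_mul_Ioi (by linarith)]
    have hq : (1 - (t : ℝ)) / t + l = (1 + (l - 1) * t) / t := by field_simp; ring
    have : 1 - (t : ℝ) ≠ 0 := (sub_pos.2 ht1).ne'
    simp only [mobiusInterior, mem_singleton_iff, h0, h1, not_false_eq_true, indicator_of_notMem,
      mul_zero, add_zero, sub_zero, hq, Real.exp_zero]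
    have hpd : 1 + (l - 1) * (t : ℝ) - 1 + t = l * t := by ring
    generalize 1 + (l - 1) * (t : ℝ) = p at hp hpd
    field_simp
    linear_combination hpd
  · simp only [e]
    exact (hi.sub hi').const_mul _
  · refine (ae_restrict_mem measurableSet_Ioi).mono fun x hx => ?_
    refine mul_nonneg (sub_nonneg.2 (Real.exp_le_one_iff.2 ?_))
      (by simpa using levyDensityDeriv_sign 0 x t)
    have := mul_pos hl hx
    linarith

/-- The measure on `(0,∞)` with density `levyDensity P`. -/
noncomputable def levyDensityMeasure (P : Measure (Icc (0 : ℝ) 1)) : Measure ℝ :=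
  (volume.restrict (Ioi (0 : ℝ))).withDensity fun x => ENNReal.ofReal (levyDensity P x)

theorem restrict_levyDensityMeasure (P : Measure (Icc (0 : ℝ) 1)) :
    (levyDensityMeasure P).restrict (Ioi 0) = levyDensityMeasure P := by
  rw [levyDensityMeasure, restrict_withDensity measurableSet_Ioi,
    Measure.restrict_restrict measurableSet_Ioi, inter_self]

/-- Tonelli's theorem in `ℝ≥0∞`, so no integrability against the Lévy measure is presupposed. Its
finiteness is instead a consequence. -/
theorem lintegral_one_sub_exp_levyDensityMeasure (P : Measure (Icc (0 : ℝ) 1)) [IsFiniteMeasure P]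
    {l : ℝ} (hl : 0 < l) :
    ∫⁻ x in Ioi (0 : ℝ), ENNReal.ofReal (1 - Real.exp (-(l * x))) ∂(levyDensityMeasure P) =
      ENNReal.ofReal ((∫ t : Icc (0 : ℝ) 1, l / (1 + (l - 1) * (t : ℝ)) ∂P) -
        (P.real {1} + l * P.real {0})) := by
  have hmeas : AEMeasurable (fun x => ENNReal.ofReal (levyDensity P x))
      (volume.restrict (Ioi 0)) :=
    ((isCompletelyMonotone_levyDensity P).contDiffOn.continuousOn.aemeasurable
      measurableSet_Ioi).ennreal_ofReal
  rw [restrict_levyDensityMeasure, levyDensityMeasure,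
    lintegral_withDensity_eq_lintegral_mul₀ hmeas (by fun_prop)]
  have hnn : ∀ x ∈ Ioi (0 : ℝ), 0 ≤ 1 - Real.exp (-(l * x)) := fun x hx =>
    sub_nonneg.2 (Real.exp_le_one_iff.2 (by have := mul_pos hl hx; linarith))
  have e : ∀ x ∈ Ioi (0 : ℝ), ((fun x => ENNReal.ofReal (levyDensity P x)) *
      fun x => ENNReal.ofReal (1 - Real.exp (-(l * x)))) x =
      ∫⁻ t, ENNReal.ofReal ((1 - Real.exp (-(l * x))) * levyDensityDeriv 0 x t) ∂P := by
    intro x hx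
    simp only [Pi.mul_apply, ENNReal.ofReal_mul (hnn x hx)]
    rw [lintegral_const_mul _
      ((measurable_levyDensityDeriv 0).of_uncurry_left (x := x)).ennreal_ofReal,
      ofReal_levyDensity P hx, mul_comm]
  rw [setLIntegral_congr_fun measurableSet_Ioi e, lintegral_lintegral_swap]
  · obtain ⟨hi, he⟩ := integrable_mobiusInterior_and_integral_eq P hl
    simp only [lintegral_one_sub_exp_mul_levyDensityDeriv hl]
    rw [← ofReal_integral_eq_lintegral_ofReal hi (ae_of_all _ (mobiusInterior_nonneg hl)), he]
  · refine Measurable.aemeasurable ?_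
    have := measurable_levyDensityDeriv 0
    unfold Function.uncurry at this ⊢
    fun_prop

/-- From `e^x ≥ 1 + x`, `1 - e^{-x} ≥ x/(1+x)`. The factor `2` covers `1 + x ≤ 2` for `x ≤ 1` and `1
+ x ≤ 2x` for `x ≥ 1`. -/
theorem min_le_two_mul_one_sub_exp {x : ℝ} (hx : 0 < x) :
    min x 1 ≤ 2 * (1 - Real.exp (-x)) := by
  have h1 : Real.exp (-x) ≤ 1 / (1 + x) := by
    rw [Real.exp_neg, ← one_div]
    exact one_div_le_one_div_of_le (by positivity) (by linarith [Real.add_one_le_exp x])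
  have h2 : min x 1 ≤ 2 * (1 - 1 / (1 + x)) := by
    have : 2 * (1 - 1 / (1 + x)) = 2 * x / (1 + x) := by field_simp; ring
    rw [this, le_div_iff₀ (by positivity)]
    rcases le_total x 1 with h | h
    · rw [min_eq_left h]; nlinarith
    · rw [min_eq_right h]; linarith
  linarith

theorem isLevyMeasure_levyDensityMeasure (P : Measure (Icc (0 : ℝ) 1)) [IsFiniteMeasure P] :
    IsLevyMeasure (levyDensityMeasure P) := by
  refine ⟨?_, ?_⟩
  · rw [← restrict_levyDensityMeasure, Measure.restrict_apply measurableSet_Iic, Iic_inter_Ioi,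
      Ioc_self, measure_empty]
  -- The Lévy condition follows from the representation at the single point `l = 1`.
  · calc _ ≤ ∫⁻ x in Ioi (0 : ℝ), ENNReal.ofReal 2 * ENNReal.ofReal (1 - Real.exp (-(1 * x)))
          ∂(levyDensityMeasure P) := by
          refine setLIntegral_mono' measurableSet_Ioi fun x hx => ?_
          rw [← ENNReal.ofReal_mul zero_le_two, one_mul]
          exact ENNReal.ofReal_le_ofReal (min_le_two_mul_one_sub_exp hx)
      _ < ⊤ := by
          rw [lintegral_const_mul _ (by fun_prop),
            lintegral_one_sub_exp_levyDensityMeasure P one_pos]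
          exact ENNReal.mul_lt_top ENNReal.ofReal_lt_top ENNReal.ofReal_lt_top

theorem isLevyKhintchineTriplet_integral_mobius (P : Measure (Icc (0 : ℝ) 1)) [IsFiniteMeasure P]
    {f : ℝ → ℝ}
    (hf : ∀ l ∈ Ioi (0 : ℝ), f l = ∫ t : Icc (0 : ℝ) 1, l / (1 + (l - 1) * (t : ℝ)) ∂P) :
    IsLevyKhintchineTriplet f (P.real {1}) (P.real {0}) (levyDensityMeasure P) := by
  refine ⟨measureReal_nonneg, measureReal_nonneg, isLevyMeasure_levyDensityMeasure P,
    fun l hl => ?_⟩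
  have hl0 : 0 < l := hl
  have hnn : 0 ≤ (∫ t : Icc (0 : ℝ) 1, l / (1 + (l - 1) * (t : ℝ)) ∂P) -
      (P.real {1} + l * P.real {0}) := by
    rw [← (integrable_mobiusInterior_and_integral_eq P hl0).2]
    exact integral_nonneg (mobiusInterior_nonneg hl0)
  have hν : ∫ x in Ioi (0 : ℝ), (1 - Real.exp (-(l * x))) ∂(levyDensityMeasure P) =
      (∫ t : Icc (0 : ℝ) 1, l / (1 + (l - 1) * (t : ℝ)) ∂P) - (P.real {1} + l * P.real {0}) := by
    rw [integral_eq_lintegral_of_nonneg_ae, lintegral_one_sub_exp_levyDensityMeasure P hl0,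
      ENNReal.toReal_ofReal hnn]
    · refine (ae_restrict_mem measurableSet_Ioi).mono fun x hx => ?_
      exact sub_nonneg.2 (Real.exp_le_one_iff.2 (by have := mul_pos hl0 hx; linarith))
    · exact Measurable.aestronglyMeasurable (by fun_prop)
  rw [hf l hl, hν]
  ring

/-- Almost everywhere measurability with respect to Lebesgue measure on `[0,1]` is Lebesgue
measurability; Borel measurable functions are included. -/
theorem mainTheorem1 (α : Set.Icc (0 : ℝ) 1 → Set.Icc (0 : ℝ) 1)
    (hα : AEMeasurable α MeasureTheory.volume) :
    IsCompleteBernstein (marchalPhi α) := by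
  obtain ⟨P, hP⟩ := exists_marchalPhi_eq_integral α hα
  exact ⟨isBernstein_integral_mobius P hP, _, _, _, isLevyKhintchineTriplet_integral_mobius P hP,
    levyDensity P, isCompletelyMonotone_levyDensity P, rfl⟩
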